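/- \textbf{Setting.} An instance of $[0/1]$-\textsc{Optimal House Allocation} consists of a set $A$ of $n$ agents, a set $H$ of $m$ houses, a binary utility $u_a(h)\in\{0,1\}$ for every agent $a\in A$ and every house $h\in H$, and an integer $k\ge 0$. An allocation is an injection $\Phi\colon A\to H$. Agent $a$ envies agent $b$ under $\Phi$ if $u_a(\Phi(a))<u_a(\Phi(b))$, and $a$ is envious under $\Phi$ if $a$ envies at least one agent. The problem is to decide whether there is an allocation with at most $k$ envious agents. The instance has an extremal interval structure if there is an ordering $\sigma$ of the houses such that for every agent $a$ the set $\{h\in H : u_a(h)=1\}$ of the houses valued by $a$ is a (possibly empty) prefix or suffix of $\sigma$. \textbf{Theorem.} $[0/1]$-\textsc{Optimal House Allocation} is solvable in polynomial time on instances with an extremal interval structure. That is, there are a single algorithm and a polynomial $p$ such that, given $n$, $m$, $k$ and the $n\times m$ matrix of utilities of any instance with an extremal interval structure (the ordering $\sigma$ is not part of the input), the algorithm correctly decides whether some allocation has at most $k$ envious agents, and does so within $p(n+m)$ steps on a unit-cost random access machine whose arithmetic operations are addition and truncated subtraction. -/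

import Mathlib

/-! Part 1: the machine model, a random access machine programmed by structured programs. -/

namespace RAM

/-- Memory: registers `x₀, x₁, …` and arrays `A₀, A₁, …`, all holding natural numbers.
A program mentions only finitely many registers and finitely many arrays. -/
structure Store where
  reg : ℕ → ℕ
  arr : ℕ → ℕ → ℕ

/-- Expressions. There is no multiplication: addition and truncated subtraction are the only
arithmetic operations, so that a run of `t` unit-cost steps handles numbers with at most `t` bits
more than those in the input and the program, and polynomial time on this machine is polynomial time on a Turing
machine. -/
inductive Expr where
  | const (c : ℕ)
  | reg (x : ℕ)
  | get (A : ℕ) (i : Expr)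
  | add (e f : Expr)
  | sub (e f : Expr)

/-- Value of an expression. -/
def Expr.eval (s : Store) : Expr → ℕ
  | .const c => c
  | .reg x => s.reg x
  | .get A i => s.arr A (i.eval s)
  | .add e f => e.eval s + f.eval s
  | .sub e f => e.eval s - f.eval s

/-- Number of unit-cost steps needed to evaluate an expression: one for each constant, register
access, array access and arithmetic operation in it. -/
def Expr.cost : Expr → ℕ
  | .const _ => 1
  | .reg _ => 1
  | .get _ i => i.cost + 1
  | .add e f => e.cost + f.cost + 1
  | .sub e f => e.cost + f.cost + 1

/-- Programs. -/
inductive Cmd where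
  /-- do nothing -/
  | skip
  /-- `x := e` -/
  | assign (x : ℕ) (e : Expr)
  /-- `A[i] := e` -/
  | set (A : ℕ) (i e : Expr)
  /-- `c; d` -/
  | seq (c d : Cmd)
  /-- `if e ≠ 0 then c else d` -/
  | cond (e : Expr) (c d : Cmd)
  /-- `while e ≠ 0 do c` -/
  | loop (e : Expr) (c : Cmd)

/-- The store after `x := v`. -/
def Store.setReg (s : Store) (x v : ℕ) : Store :=
  { s with reg := Function.update s.reg x v }

/-- The store after `A[i] := v`. -/
def Store.setArr (s : Store) (A i v : ℕ) : Store :=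
  { s with arr := Function.update s.arr A (Function.update (s.arr A) i v) }

/-- `Exec c s s' t`: the program `c`, started in the store `s`, halts in the store `s'` after
exactly `t` steps. -/
inductive Exec : Cmd → Store → Store → ℕ → Prop where
  | skip (s : Store) : Exec .skip s s 1
  | assign (s : Store) (x : ℕ) (e : Expr) :
      Exec (.assign x e) s (s.setReg x (e.eval s)) (e.cost + 1)
  | set (s : Store) (A : ℕ) (i e : Expr) :
      Exec (.set A i e) s (s.setArr A (i.eval s) (e.eval s)) (i.cost + e.cost + 1)
  | seq {c d : Cmd} {s s' s'' : Store} {t u : ℕ} :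
      Exec c s s' t → Exec d s' s'' u → Exec (.seq c d) s s'' (t + u)
  | cond_true {e : Expr} {c d : Cmd} {s s' : Store} {t : ℕ} :
      e.eval s ≠ 0 → Exec c s s' t → Exec (.cond e c d) s s' (e.cost + 1 + t)
  | cond_false {e : Expr} {c d : Cmd} {s s' : Store} {t : ℕ} :
      e.eval s = 0 → Exec d s s' t → Exec (.cond e c d) s s' (e.cost + 1 + t)
  | loop_done {e : Expr} {c : Cmd} {s : Store} :
      e.eval s = 0 → Exec (.loop e c) s s (e.cost + 1)
  | loop_step {e : Expr} {c : Cmd} {s s' s'' : Store} {t u : ℕ} :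
      e.eval s ≠ 0 → Exec c s s' t → Exec (.loop e c) s' s'' u →
      Exec (.loop e c) s s'' (e.cost + 1 + t + u)

/-- A (promise) decision problem, with instances of type `ι` presented to the machine as the
initial store `input I` and of size `size I`, is solvable in polynomial time: one program, on every
instance that satisfies `promise`, halts within a number of steps bounded by a fixed polynomial in
the size, with the answer (`1` for yes and `0` for no) in register `0`. -/
def SolvableInPolyTime {ι : Type} (input : ι → Store) (size : ι → ℕ) (promise yes : ι → Prop) :
    Prop :=
  ∃ (c : Cmd) (p : Polynomial ℕ), ∀ I : ι, promise I →
    ∃ (s' : Store) (t : ℕ), Exec c (input I) s' t ∧ t ≤ p.eval (size I) ∧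
      (yes I → s'.reg 0 = 1) ∧ (¬ yes I → s'.reg 0 = 0)

end RAM

/-! Part 2: house allocation with binary utilities. -/

/-- An instance: `n` agents, `m` houses, the binary utilities `u a h` of the agents for the houses,
and the bound `k` on the number of envious agents. -/
structure BinaryOHA where
  n : ℕ
  m : ℕ
  u : Fin n → Fin m → Fin 2
  k : ℕ

namespace BinaryOHA

/-- An allocation is an injection from the agents to the houses. -/
abbrev Allocation (I : BinaryOHA) : Type := Fin I.n ↪ Fin I.m

/-- The set of houses that agent `a` values. -/
def valued (I : BinaryOHA) (a : Fin I.n) : Set (Fin I.m) := {h | I.u a h = 1}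

/-- Agent `a` envies agent `b` under `Φ`. -/
def Envies (I : BinaryOHA) (Φ : I.Allocation) (a b : Fin I.n) : Prop :=
  I.u a (Φ a) < I.u a (Φ b)

/-- The amount of envy experienced by `a`: the number of agents that `a` envies. -/
noncomputable def envy (I : BinaryOHA) (Φ : I.Allocation) (a : Fin I.n) : ℕ :=
  {b : Fin I.n | I.Envies Φ a b}.ncard

/-- The number of envious agents. -/
noncomputable def numEnvious (I : BinaryOHA) (Φ : I.Allocation) : ℕ :=
  {a : Fin I.n | 1 ≤ I.envy Φ a}.ncard

/-- Yes-instances: some allocation has at most `k` envious agents. -/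
def IsYes (I : BinaryOHA) : Prop := ∃ Φ : I.Allocation, I.numEnvious Φ ≤ I.k

/-- Extremal interval structure: for some ordering `σ 0, σ 1, …, σ (m - 1)` of the houses, every
agent values exactly the houses of a (possibly empty) prefix or of a (possibly empty) suffix. -/
def IsExtremal (I : BinaryOHA) : Prop :=
  ∃ σ : Fin I.m ≃ Fin I.m, ∀ a : Fin I.n,
    (∃ i : ℕ, I.valued a = {h | (σ.symm h : ℕ) < i}) ∨
    (∃ i : ℕ, I.valued a = {h | i ≤ (σ.symm h : ℕ)})

/-- The input to the machine: `n`, `m`, `k` in the registers `0`, `1`, `2`, and the utility matrix,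
row by row, in array `0` (entry `a * m + h` is the utility of agent `a` for house `h`). All other
memory cells hold `0`. -/
def input (I : BinaryOHA) : RAM.Store where
  reg x := if x = 0 then I.n else if x = 1 then I.m else if x = 2 then I.k else 0
  arr A i :=
    if A = 0 then
      if hi : i < I.n * I.m then
        (I.u (Fin.divNat (⟨i, hi⟩ : Fin (I.n * I.m))) (Fin.modNat (⟨i, hi⟩ : Fin (I.n * I.m))) : ℕ)
      else 0
    else 0

/-- Running times are measured in the number of agents plus the number of houses. -/
def size (I : BinaryOHA) : ℕ := I.n + I.m

end BinaryOHA

/-! Let `a` value a smallest nonempty set of houses, and orient the ordering so that this set is a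
prefix. A nonempty prefix valued by another agent then contains the set of `a`, while a suffix
containing it contains the first house and so is everything. Hence the agents `L` valuing all houses
of `a` may be treated as prefix agents and the rest as suffix agents (`IsExtremal.exists_isSplit`).
The split is found without knowing the ordering, and depends on set sizes and inclusions only.

Fix the window `W` left after discarding the first `s` and the last `t` houses. An agent valuing
nothing in `W` cannot envy inside it; any other agent is sure to be free of envy only with a valued
house. So the task is to match the agents who value part of `W`, leaving at most `k` unmatched. By
the deficiency form of Hall's theorem only initial pieces of `W` (length `p - s`) and final pieces
(length `q - t`) can be bottlenecks. This is `Criterion`: the truncated excesses at the two ends,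
for independent `p` and `q`, add up to at most `k`. `IsSplit.criterion_of_isYes` and
`IsSplit.isYes_of_criterion` show that it is exact.

The criterion uses counts and boundedly many quantifiers over ranges of size `n + m + 1`. It is
written as one term of a small language with bounded sums, in which a nonzero sum expresses "exists"
and a zero sum "for all". Every such term compiles to a polynomial-time program
(`Tm.computes_compile`). -/

namespace RAM

/-! ### Compiling bounded-sum terms to the random access machine. -/

/-- Arithmetic terms with conditionals, lookups in array `0`, and summation of a variable over an
initial segment of `ℕ` whose length is a global parameter. -/
inductive Tm where
  | const (c : ℕ)
  | var (x : ℕ)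
  | get (i : Tm)
  | add (e f : Tm)
  | sub (e f : Tm)
  | ite (c e f : Tm)
  | sum (x : ℕ) (e : Tm)

namespace Tm

/-- Value of a term, for the array `A`, sums of length `N`, and the variable assignment `ρ`. -/
def eval (A : ℕ → ℕ) (N : ℕ) : Tm → (ℕ → ℕ) → ℕ
  | const c, _ => c
  | var x, ρ => ρ x
  | get i, ρ => A (i.eval A N ρ)
  | add e f, ρ => e.eval A N ρ + f.eval A N ρ
  | sub e f, ρ => e.eval A N ρ - f.eval A N ρ
  | ite c e f, ρ => if c.eval A N ρ ≠ 0 then e.eval A N ρ else f.eval A N ρ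
  | sum x e, ρ => ∑ i ∈ Finset.range N, e.eval A N (Function.update ρ x i)

/-- One round of the loop that computes a sum: `c` leaves the summand in register `r + 2`. -/
def sumBody (c : Cmd) (r : ℕ) : Cmd :=
  .seq c (.seq (.assign r (.add (.reg r) (.reg (r + 2))))
    (.assign (r + 1) (.add (.reg (r + 1)) (.const 1))))

/-- A program that leaves the value of a term in register `r`, keeping all lower registers. The
variable `x` is read from register `κ x`, and the length of sums from register `3`. -/
def compile : Tm → (ℕ → ℕ) → ℕ → Cmd
  | const c, _, r => .assign r (.const c)
  | var x, κ, r => .assign r (.reg (κ x))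
  | get i, κ, r => .seq (i.compile κ r) (.assign r (.get 0 (.reg r)))
  | add e f, κ, r => .seq (e.compile κ r)
      (.seq (f.compile κ (r + 1)) (.assign r (.add (.reg r) (.reg (r + 1)))))
  | sub e f, κ, r => .seq (e.compile κ r)
      (.seq (f.compile κ (r + 1)) (.assign r (.sub (.reg r) (.reg (r + 1)))))
  | ite c e f, κ, r => .seq (c.compile κ r) (.cond (.reg r) (e.compile κ r) (f.compile κ r))
  | sum x e, κ, r => .seq (.assign r (.const 0)) (.seq (.assign (r + 1) (.const 0))
      (.loop (.sub (.reg 3) (.reg (r + 1)))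
        (sumBody (e.compile (Function.update κ x (r + 1)) (r + 2)) r)))

/-- Bound for the running time of the compiled program, as a polynomial in the length of sums. -/
noncomputable def cost : Tm → Polynomial ℕ
  | const _ => 2
  | var _ => 2
  | get i => i.cost + 3
  | add e f => e.cost + f.cost + 4
  | sub e f => e.cost + f.cost + 4
  | ite c e f => c.cost + e.cost + f.cost + 2
  | sum _ e => Polynomial.X * (e.cost + 12) + 8

end Tm

/-- The program `c`, started in `s`, halts within `T` steps with `v` in register `r`, and changes
no register below `r` and no array. -/
def Computes (c : Cmd) (s : Store) (T r v : ℕ) : Prop :=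
  ∃ (s' : Store) (t : ℕ), Exec c s s' t ∧ t ≤ T ∧ s'.reg r = v ∧ (∀ x < r, s'.reg x = s.reg x) ∧
    s'.arr = s.arr

theorem Computes.assign (s : Store) (r : ℕ) (e : Expr) :
    Computes (.assign r e) s (e.cost + 1) r (e.eval s) :=
  ⟨_, _, .assign s r e, le_rfl, by simp [Store.setReg],
    fun x hx => by simp [Store.setReg, hx.ne], rfl⟩

theorem Computes.seq {c d : Cmd} {s : Store} {T U r q v w : ℕ} (hrq : r ≤ q)
    (hc : Computes c s T q v)
    (hd : ∀ s' : Store, s'.reg q = v → (∀ x < q, s'.reg x = s.reg x) → s'.arr = s.arr →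
      Computes d s' U r w) : Computes (.seq c d) s (T + U) r w := by
  obtain ⟨s', t, h, ht, hv, hx, hA⟩ := hc
  obtain ⟨s'', u, h', hu, hw, hx', hA'⟩ := hd s' hv hx hA
  exact ⟨s'', _, .seq h h', by omega, hw,
    fun x hxr => (hx' x hxr).trans (hx x (by omega)), hA'.trans hA⟩

theorem Computes.mono {c : Cmd} {s : Store} {T U r v w : ℕ} (h : Computes c s T r v) (hTU : T ≤ U)
    (hvw : v = w) : Computes c s U r w := by
  obtain ⟨s', t, h, ht, hv, hx⟩ := h
  exact ⟨s', t, h, ht.trans hTU, hv.trans hvw, hx⟩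

namespace Tm

/-- Induction on the number `j` of remaining rounds, with the accumulator in `r` and the index in `r
+ 1`. A round costs 4 for the guard and 4 for each of the two assignments besides the summand; the
last 4 is the failing guard. -/
theorem computes_sumLoop {c : Cmd} {r N T : ℕ} {A : ℕ → ℕ → ℕ} {R : ℕ → ℕ} {F : ℕ → ℕ}
    (hr : 3 < r) (hN : R 3 = N)
    (hc : ∀ s : Store, s.arr = A → (∀ x < r, s.reg x = R x) →
      Computes c s T (r + 2) (F (s.reg (r + 1)))) (j : ℕ) :
    ∀ (s : Store) (i : ℕ), s.arr = A → (∀ x < r, s.reg x = R x) → s.reg (r + 1) = i → i + j = N →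
      Computes (.loop (.sub (.reg 3) (.reg (r + 1))) (sumBody c r)) s (j * (T + 12) + 4) r
        (s.reg r + ∑ l ∈ Finset.range j, F (i + l)) := by
  induction j with
  | zero =>
    intro s i hA hR hi hij
    refine ⟨s, _, .loop_done ?_, by simp [Expr.cost], by simp, fun _ _ => rfl, rfl⟩
    simp only [Expr.eval, hR 3 hr, hi]
    omega
  | succ j ih =>
    intro s i hA hR hi hij
    obtain ⟨s₁, t₁, h₁, ht₁, hv₁, hx₁, hA₁⟩ := hc s hA hR
    obtain ⟨s₃, hs₃⟩ : ∃ s₃ : Store, s₃ = (s₁.setReg r (s₁.reg r + s₁.reg (r + 2))).setReg (r + 1)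
      (s₁.reg (r + 1) + 1) := ⟨_, rfl⟩
    have hbody : Exec (sumBody c r) s s₃ (t₁ + (4 + 4)) := by
      refine .seq h₁ (.seq (.assign _ _ _) ?_)
      convert Exec.assign _ _ _ using 1
      · simp [hs₃, Expr.eval, Store.setReg]
      · rfl
    have hr₁ : s₃.reg (r + 1) = i + 1 := by
      simp [hs₃, Store.setReg, hx₁ (r + 1) (by omega), hi]
    have hr₀ : s₃.reg r = s.reg r + F i := by
      simp [hs₃, Store.setReg, hx₁ r (by omega), hv₁, hi]
    have hlow : ∀ x < r, s₃.reg x = s.reg x := by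
      intro x hx
      have h1 : x ≠ r := by omega
      have h2 : x ≠ r + 1 := by omega
      simp [hs₃, Store.setReg, hx₁ x (by omega), h1, h2]
    have hA₃ : s₃.arr = s.arr := by simp [hs₃, Store.setReg, hA₁]
    obtain ⟨s', t, h, ht, hv, hx, hA'⟩ := ih s₃ (i + 1) (hA₃.trans hA)
      (fun x hx => (hlow x hx).trans (hR x hx)) hr₁ (by omega)
    refine ⟨s', _, .loop_step ?_ hbody h, ?_, ?_, fun x hxr => (hx x hxr).trans (hlow x hxr),
      hA'.trans hA₃⟩
    · simp only [Expr.eval, hR 3 hr, hi]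
      omega
    · simp only [Expr.cost]
      rw [Nat.succ_mul]
      omega
    · rw [hv, hr₀, Finset.sum_range_succ', add_zero, add_assoc, add_comm (F i)]
      congr 2
      exact Finset.sum_congr rfl fun l _ => by congr 1; omega

/-- Variables live below `r` and scratch space starts at `r`, so subterms cannot destroy them. A sum
puts its bound variable in `r + 1` and compiles its body from `r + 2`, which keeps this discipline.
-/
theorem computes_compile (e : Tm) : ∀ (κ : ℕ → ℕ) (r : ℕ) (ρ : ℕ → ℕ) (s : Store) (N : ℕ), 3 < r →
    (∀ y, κ y < r) → s.reg 3 = N → (∀ y, s.reg (κ y) = ρ y) →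
    Computes (e.compile κ r) s (e.cost.eval N) r (e.eval (s.arr 0) N ρ) := by
  induction e with
  | const c =>
    intro κ r ρ s N hr hκ hN hρ
    exact (Computes.assign _ _ _).mono (by simp [cost, Expr.cost]) rfl
  | var x =>
    intro κ r ρ s N hr hκ hN hρ
    exact (Computes.assign _ _ _).mono (by simp [cost, Expr.cost]) (hρ x)
  | get i ih =>
    intro κ r ρ s N hr hκ hN hρ
    refine ((ih κ r ρ s N hr hκ hN hρ).seq (U := 3) le_rfl fun s' hv hx hA => ?_).mono
      (by simp [cost]) rfl
    exact (Computes.assign _ _ _).mono (by simp [Expr.cost]) (by simp [Expr.eval, hv, hA, eval])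
  | add e f ihe ihf =>
    intro κ r ρ s N hr hκ hN hρ
    refine ((ihe κ r ρ s N hr hκ hN hρ).seq (U := f.cost.eval N + 4) le_rfl
      fun s' hv hx hA => ?_).mono (by simp [cost]; omega) rfl
    refine (ihf κ (r + 1) ρ s' N (by omega) (fun y => (hκ y).trans (by omega))
      ((hx 3 hr).trans hN) (fun y => (hx _ (hκ y)).trans (hρ y))).seq (by omega)
      fun s'' hv' hx' hA' => ?_
    exact (Computes.assign _ _ _).mono (by simp [Expr.cost])
      (by simp [Expr.eval, hv', hx' r, hv, hA, eval])
  | sub e f ihe ihf =>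
    intro κ r ρ s N hr hκ hN hρ
    refine ((ihe κ r ρ s N hr hκ hN hρ).seq (U := f.cost.eval N + 4) le_rfl
      fun s' hv hx hA => ?_).mono (by simp [cost]; omega) rfl
    refine (ihf κ (r + 1) ρ s' N (by omega) (fun y => (hκ y).trans (by omega))
      ((hx 3 hr).trans hN) (fun y => (hx _ (hκ y)).trans (hρ y))).seq (by omega)
      fun s'' hv' hx' hA' => ?_
    exact (Computes.assign _ _ _).mono (by simp [Expr.cost])
      (by simp [Expr.eval, hv', hx' r, hv, hA, eval])
  | ite c e f ihc ihe ihf =>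
    intro κ r ρ s N hr hκ hN hρ
    refine ((ihc κ r ρ s N hr hκ hN hρ).seq (U := e.cost.eval N + f.cost.eval N + 2) le_rfl
      fun s' hv hx hA => ?_).mono (by simp [cost]; omega) rfl
    have hρ' : ∀ y, s'.reg (κ y) = ρ y := fun y => (hx _ (hκ y)).trans (hρ y)
    by_cases h0 : c.eval (s.arr 0) N ρ = 0
    · obtain ⟨s'', t, h, ht, hw⟩ := ihf κ r ρ s' N hr hκ ((hx 3 hr).trans hN) hρ'
      exact ⟨s'', _, .cond_false (by simp [Expr.eval, hv, h0]) h, by simp [Expr.cost]; omega,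
        by simpa [eval, h0, hA] using hw⟩
    · obtain ⟨s'', t, h, ht, hw⟩ := ihe κ r ρ s' N hr hκ ((hx 3 hr).trans hN) hρ'
      exact ⟨s'', _, .cond_true (by simp [Expr.eval, hv, h0]) h, by simp [Expr.cost]; omega,
        by simpa [eval, h0, hA] using hw⟩
  | sum x e ih =>
    intro κ r ρ s N hr hκ hN hρ
    refine ((Computes.assign s r (.const 0)).seq (U := 2 + (N * (e.cost.eval N + 12) + 4)) le_rfl
      fun s₁ hv₁ hx₁ hA₁ => ?_).mono (by simp [cost, Expr.cost]; omega) rfl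
    refine (Computes.assign s₁ (r + 1) (.const 0)).seq (by omega) fun s₂ hv₂ hx₂ hA₂ => ?_
    have hlow : ∀ x < r, s₂.reg x = s.reg x := fun x hx =>
      (hx₂ x (by omega)).trans (hx₁ x hx)
    have key := computes_sumLoop (c := e.compile (Function.update κ x (r + 1)) (r + 2)) (r := r)
      (N := N) (T := e.cost.eval N) (A := s.arr) (R := s.reg)
      (F := fun i => e.eval (s.arr 0) N (Function.update ρ x i)) hr hN ?_ N s₂ 0 (hA₂.trans hA₁) hlow
      hv₂ (by omega)
    · exact key.mono le_rfl (by simp [hx₂ r, hv₁, Expr.eval, eval])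
    · intro s' hA hR
      rw [← hA]
      refine ih _ _ _ _ _ (by omega) (fun y => ?_) ((hR 3 hr).trans hN) (fun y => ?_)
      · rcases eq_or_ne y x with rfl | h
        · simp
        · simpa [h] using (hκ y).trans (by omega)
      · rcases eq_or_ne y x with rfl | h
        · simp
        · simp [h, hR _ (hκ y), hρ]

end Tm

end RAM

/-! ### Recovering prefix and suffix agents from an extremal structure. -/

namespace BinaryOHA

variable {I : BinaryOHA}

/-- The number of houses valued by an agent. -/
def numValued (I : BinaryOHA) (a : Fin I.n) : ℕ := Finset.card {h | I.u a h = 1}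

/-- With the houses ordered by `pos`, the agents in `L` value prefixes and the others suffixes. -/
structure IsSplit (I : BinaryOHA) (pos : Equiv.Perm (Fin I.m)) (L : Fin I.n → Prop) : Prop where
  left : ∀ b, L b → ∀ h, I.u b h = 1 ↔ (pos h : ℕ) < I.numValued b
  right : ∀ b, ¬ L b → ∀ h, I.u b h = 1 ↔ I.m ≤ pos h + I.numValued b

theorem card_filter_perm {m : ℕ} (pos : Equiv.Perm (Fin m)) (P : ℕ → Prop) [DecidablePred P] :
    Finset.card {h | P (pos h)} = Finset.card {x ∈ Finset.range m | P x} := by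
  refine Finset.card_bij (fun h _ => (pos h : ℕ)) (by simp) (fun a _ b _ hab => ?_) fun x hx => ?_
  · exact pos.injective (Fin.ext hab)
  · simp only [Finset.mem_filter, Finset.mem_range] at hx
    exact ⟨pos.symm ⟨x, hx.1⟩, by simpa using hx.2, by simp⟩

theorem numValued_le (a : Fin I.n) : I.numValued a ≤ I.m :=
  (Finset.card_filter_le _ _).trans (by simp)

/-- The cutoff `i` may exceed `m`; replacing it by the size of the set makes it computable from the
utilities alone. -/
theorem iff_lt_numValued {pos : Equiv.Perm (Fin I.m)} {b : Fin I.n} {i : ℕ}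
    (hb : ∀ h, I.u b h = 1 ↔ (pos h : ℕ) < i) (h : Fin I.m) :
    I.u b h = 1 ↔ (pos h : ℕ) < I.numValued b := by
  have : I.numValued b = min I.m i := by
    simp only [numValued, hb]
    rw [card_filter_perm pos (· < i), ← Finset.card_range (min I.m i)]
    congr 1
    ext x
    simp
  rw [hb, this]
  have := (pos h).2
  omega

theorem iff_le_add_numValued {pos : Equiv.Perm (Fin I.m)} {b : Fin I.n} {i : ℕ}
    (hb : ∀ h, I.u b h = 1 ↔ i ≤ (pos h : ℕ)) (h : Fin I.m) :
    I.u b h = 1 ↔ I.m ≤ pos h + I.numValued b := by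
  have : I.numValued b = I.m - i := by
    simp only [numValued, hb]
    rw [card_filter_perm pos (i ≤ ·), ← Nat.card_Ico i I.m]
    congr 1
    ext x
    simp [and_comm]
  rw [hb, this]
  have := (pos h).2
  omega

theorem IsExtremal.exists_perm (hI : I.IsExtremal) (a : Fin I.n) :
    ∃ pos : Equiv.Perm (Fin I.m), (∀ h, I.u a h = 1 ↔ (pos h : ℕ) < I.numValued a) ∧
      ∀ b, (∀ h, I.u b h = 1 ↔ (pos h : ℕ) < I.numValued b) ∨
        ∀ h, I.u b h = 1 ↔ I.m ≤ pos h + I.numValued b := by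
  obtain ⟨σ, hσ⟩ := hI
  simp only [valued, Set.ext_iff, Set.mem_ofPred_eq] at hσ
  rcases hσ a with ⟨i, hi⟩ | ⟨i, hi⟩
  · refine ⟨σ.symm, iff_lt_numValued hi, fun b => ?_⟩
    rcases hσ b with ⟨j, hj⟩ | ⟨j, hj⟩
    · exact .inl (iff_lt_numValued hj)
    · exact .inr (iff_le_add_numValued hj)
  -- Reversing the ordering exchanges prefixes and suffixes, so `a` becomes a prefix agent.
  · refine ⟨σ.symm.trans Fin.revPerm, iff_lt_numValued (i := I.m - i) fun h => ?_, fun b => ?_⟩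
    · have := (σ.symm h).2
      simp only [hi, Equiv.trans_apply, Fin.revPerm_apply, Fin.val_rev]
      omega
    · rcases hσ b with ⟨j, hj⟩ | ⟨j, hj⟩
      · refine .inr (iff_le_add_numValued (i := I.m - j) fun h => ?_)
        have := (σ.symm h).2
        simp only [hj, Equiv.trans_apply, Fin.revPerm_apply, Fin.val_rev]
        omega
      · refine .inl (iff_lt_numValued (i := I.m - j) fun h => ?_)
        have := (σ.symm h).2
        simp only [hj, Equiv.trans_apply, Fin.revPerm_apply, Fin.val_rev]
        omega

/-- If `a` values a smallest nonempty set of houses, then the agents who value all these houses are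
on one side, and the others can be taken to be on the other side. -/
theorem IsExtremal.exists_isSplit (hI : I.IsExtremal) (a : Fin I.n)
    (ha : ∀ b, I.numValued b ≠ 0 → I.numValued a ≠ 0 ∧ I.numValued a ≤ I.numValued b) :
    ∃ pos, I.IsSplit pos fun b => ∀ h, I.u a h = 1 → I.u b h = 1 := by
  obtain ⟨pos, hpos, hall⟩ := hI.exists_perm a
  refine ⟨pos, fun b hb => (hall b).elim id fun hs => ?_, fun b hb => (hall b).elim ?_ id⟩
  · intro h
    by_cases h0 : I.numValued a = 0
    · have hb0 : I.numValued b = 0 := by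
        by_contra hne
        exact (ha b hne).1 h0
      have := (pos h).2
      rw [hs, hb0]
      omega
    · have hm := h.pos
      -- The nonempty prefix of `a` contains position 0, so a suffix containing it is the whole line
      -- and hence a prefix.
      have := hb (pos.symm ⟨0, hm⟩) ((hpos _).2 (by simp; omega))
      rw [hs] at this ⊢
      have := (pos h).2
      simp at *
      omega
  · intro hs h
    -- The empty set is also a suffix. A nonempty prefix is at least as long as that of `a`, which
    -- would put `b` in `L`.
    by_cases h0 : I.numValued b = 0
    · have := (pos h).2
      rw [hs, h0]
      omega
    · refine absurd (fun h hh => ?_) hb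
      rw [hpos] at hh
      rw [hs]
      exact hh.trans_le (ha b h0).2

/-! ### The window criterion and its equivalence with a yes-instance. -/

section Criterion

open Classical in
/-- The number of agents in `L` who value more than `s` and at most `p` houses. -/
noncomputable def count (I : BinaryOHA) (L : Fin I.n → Prop) (s p : ℕ) : ℕ :=
  Finset.card {b | L b ∧ s < I.numValued b ∧ I.numValued b ≤ p}

/-- Discarding the first `s` and the last `t` houses leaves enough houses, and at most `k` agents
who value some of these houses cannot be matched to houses they value. -/
def Criterion (I : BinaryOHA) (L : Fin I.n → Prop) : Prop :=
  ∃ s < I.n + I.m + 1, ∃ t < I.n + I.m + 1, s + t + I.n ≤ I.m ∧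
    ∀ p < I.n + I.m + 1, ∀ q < I.n + I.m + 1,
      (I.count L s p - (p - s)) + (I.count (fun b => ¬ L b) t q - (q - t)) ≤ I.k

theorem envies_iff {Φ : I.Allocation} {a b : Fin I.n} :
    I.Envies Φ a b ↔ I.u a (Φ a) ≠ 1 ∧ I.u a (Φ b) = 1 := by
  simp only [Envies]
  generalize I.u a (Φ a) = x
  generalize I.u a (Φ b) = y
  revert x y
  decide

open Classical in
theorem numEnvious_eq (Φ : I.Allocation) :
    I.numEnvious Φ = Finset.card {a | ∃ b, I.Envies Φ a b} := by
  rw [numEnvious, ← Set.ncard_coe_finset]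
  congr 1
  ext a
  simp [envy, Nat.one_le_iff_ne_zero, Set.ncard_eq_zero (Set.toFinite _),
    Set.eq_empty_iff_forall_notMem]

-- Every agent of `B` values some allocated house, so those without envy hold valued houses, and `Φ`
-- injects them into `C`. This is the easy half of the deficiency bound.
open Classical in
theorem card_le_card_add_card_envious (Φ : I.Allocation) (B : Finset (Fin I.n))
    (C : Finset (Fin I.m)) (hB : ∀ b ∈ B, ∃ a, I.u b (Φ a) = 1)
    (hC : ∀ b ∈ B, I.u b (Φ b) = 1 → Φ b ∈ C) :
    B.card ≤ C.card + Finset.card {b ∈ B | ∃ c, I.Envies Φ b c} := by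
  rw [← Finset.card_filter_add_card_filter_not (fun b => ∃ c, I.Envies Φ b c), add_comm]
  gcongr
  refine Finset.card_le_card_of_injOn Φ (fun b hb => ?_) Φ.injective.injOn
  simp only [envies_iff, not_exists, not_and, Finset.coe_filter, Set.mem_ofPred_eq] at hb
  obtain ⟨a, ha⟩ := hB b hb.1
  exact hC b hb.1 (by_contra fun h => hb.2 a h ha)

/-- Take the window spanned by the allocated houses. Its two end houses are allocated, so an agent
valuing any position in it values an allocated house, and the previous bound applies at each end.
Envious agents in and outside `L` are disjoint, so the two bounds add. -/
theorem IsSplit.criterion_of_isYes {pos : Equiv.Perm (Fin I.m)} {L : Fin I.n → Prop}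
    (hL : I.IsSplit pos L) (h : I.IsYes) : I.Criterion L := by
  classical
  obtain ⟨Φ, hΦ⟩ := h
  rcases isEmpty_or_nonempty (Fin I.n) with hn | hn
  · have hn0 : I.n = 0 := (Fintype.card_fin I.n).symm.trans (Fintype.card_eq_zero_iff.2 hn)
    exact ⟨0, by omega, 0, by omega, by omega, fun p _ q _ => by simp [count]⟩
  obtain ⟨a₁, h₁⟩ := Finite.exists_min fun a => (pos (Φ a) : ℕ)
  obtain ⟨a₂, h₂⟩ := Finite.exists_max fun a => (pos (Φ a) : ℕ)
  obtain ⟨s, hs⟩ : ∃ s, s = (pos (Φ a₁) : ℕ) := ⟨_, rfl⟩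
  obtain ⟨t, ht⟩ : ∃ t, t = I.m - 1 - (pos (Φ a₂) : ℕ) := ⟨_, rfl⟩
  have hlt₁ := (pos (Φ a₁)).2
  have hlt₂ := (pos (Φ a₂)).2
  have hcard : I.n ≤ pos (Φ a₂) + 1 - s := by
    rw [← Nat.card_Icc]
    conv_lhs => rw [← Fintype.card_fin I.n, ← Finset.card_univ]
    refine Finset.card_le_card_of_injOn (fun a => (pos (Φ a) : ℕ)) (fun a _ => ?_) ?_
    · simpa using ⟨hs ▸ h₁ a, h₂ a⟩
    · intro a _ b _ hab
      exact Φ.injective (pos.injective (Fin.ext hab))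
  have h12 := h₁ a₂
  refine ⟨s, by omega, t, by omega, by omega, fun p _ q _ => ?_⟩
  have hl : I.count L s p ≤ (p - s) + Finset.card {b | L b ∧ ∃ c, I.Envies Φ b c} := by
    refine (card_le_card_add_card_envious Φ _ {h | s ≤ (pos h : ℕ) ∧ (pos h : ℕ) < p}
      (fun b hb => ⟨a₁, ?_⟩) fun b hb hu => ?_).trans (Nat.add_le_add ?_ (Finset.card_le_card ?_))
    · simp only [Finset.mem_filter, Finset.mem_univ, true_and] at hb
      rw [hL.left b hb.1]
      omega
    · simp only [Finset.mem_filter, Finset.mem_univ, true_and] at hb ⊢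
      rw [hL.left b hb.1] at hu
      have := h₁ b
      omega
    · rw [card_filter_perm pos fun x => s ≤ x ∧ x < p, ← Nat.card_Ico]
      exact Finset.card_le_card fun x hx => by simp at hx ⊢; omega
    · intro b hb
      simp only [Finset.mem_filter, Finset.mem_univ, true_and] at hb ⊢
      exact ⟨hb.1.1, hb.2⟩
  have hr : I.count (fun b => ¬ L b) t q ≤
      (q - t) + Finset.card {b | ¬ L b ∧ ∃ c, I.Envies Φ b c} := by
    refine (card_le_card_add_card_envious Φ _ {h | I.m ≤ pos h + q ∧ pos h + t < I.m}
      (fun b hb => ⟨a₂, ?_⟩) fun b hb hu => ?_).trans (Nat.add_le_add ?_ (Finset.card_le_card ?_))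
    · simp only [Finset.mem_filter, Finset.mem_univ, true_and] at hb
      rw [hL.right b hb.1]
      omega
    · simp only [Finset.mem_filter, Finset.mem_univ, true_and] at hb ⊢
      rw [hL.right b hb.1] at hu
      have := h₂ b
      omega
    · rw [card_filter_perm pos fun x => I.m ≤ x + q ∧ x + t < I.m]
      refine (Finset.card_le_card (t := Finset.Ico (I.m - q) (I.m - t)) fun x hx => ?_).trans ?_
      · simp at hx ⊢
        omega
      · simp
        omega
    · intro b hb
      simp only [Finset.mem_filter, Finset.mem_univ, true_and] at hb ⊢
      exact ⟨hb.1.1, hb.2⟩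
  have hsum : Finset.card {b | L b ∧ ∃ c, I.Envies Φ b c} +
      Finset.card {b | ¬ L b ∧ ∃ c, I.Envies Φ b c} = I.numEnvious Φ := by
    rw [numEnvious_eq, ← Finset.card_filter_add_card_filter_not (s := {a | ∃ b, I.Envies Φ a b}) L,
      Finset.filter_filter, Finset.filter_filter]
    simp only [and_comm]
  omega

/-- Enlarge the image of `M` to a subset of `W` with exactly as many elements as `α`, then extend to
a bijection onto it. -/
theorem exists_embedding_extend {α β : Type*} [Fintype α] {W : Finset β} {M : Finset α}
    {f : α → β} (hW : Fintype.card α ≤ W.card) (hf : ∀ a ∈ M, f a ∈ W) (hinj : Set.InjOn f M) :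
    ∃ Φ : α ↪ β, (∀ a, Φ a ∈ W) ∧ ∀ a ∈ M, Φ a = f a := by
  classical
  obtain ⟨V, hMV, hVW, hV⟩ := Finset.exists_subsuperset_card_eq
    (Finset.image_subset_iff.2 hf) (Finset.card_image_le.trans M.card_le_univ) hW
  obtain ⟨g, hg⟩ := Finset.exists_equiv_extend_of_card_eq hV.symm hMV hinj
  exact ⟨g.toEmbedding.trans (Function.Embedding.subtype _), fun a => hVW (g a).2, hg⟩

/-- If each agent who values a house in `W` is matched injectively to such a house or to one of
`k` dummies, then some allocation has at most `k` envious agents. -/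
theorem isYes_of_matching {W : Finset (Fin I.m)} (hW : I.n ≤ W.card)
    (g : {a // ∃ h ∈ W, I.u a h = 1} → Fin I.m ⊕ Fin I.k) (hg : Function.Injective g)
    (hgW : ∀ a h, g a = .inl h → h ∈ W ∧ I.u a h = 1) : I.IsYes := by
  classical
  -- Only the values at agents matched to real houses matter; elsewhere `f` takes an arbitrary
  -- house.
  have hf : ∀ a : Fin I.n, ∃ h : Fin I.m, ∀ ha h', g ⟨a, ha⟩ = .inl h' → h = h' := by
    intro a
    by_cases hex : ∃ ha h', g ⟨a, ha⟩ = .inl h'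
    · obtain ⟨ha, h', hh⟩ := hex
      exact ⟨h', fun _ h'' hh' => Sum.inl.inj (hh.symm.trans hh')⟩
    · have hpos : 0 < W.card := a.pos.trans_le hW
      obtain ⟨h, -⟩ := Finset.card_pos.1 hpos
      exact ⟨h, fun ha h' hh => absurd ⟨ha, h', hh⟩ hex⟩
  choose f hf using hf
  obtain ⟨Φ, hΦW, hΦ⟩ := exists_embedding_extend (W := W) (f := f)
    (M := {a | ∃ ha h', g ⟨a, ha⟩ = .inl h'}) (by simpa using hW)
    (fun a ha => by
      simp only [Finset.mem_filter, Finset.mem_univ, true_and] at ha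
      obtain ⟨ha, h', hh⟩ := ha
      rw [hf a ha h' hh]
      exact (hgW _ _ hh).1)
    (fun a ha b hb hab => by
      simp only [Finset.coe_filter, Finset.mem_univ, true_and, Set.mem_ofPred_eq] at ha hb
      obtain ⟨ha, h', hh⟩ := ha
      obtain ⟨hb, h'', hh'⟩ := hb
      rw [hf a ha h' hh, hf b hb h'' hh'] at hab
      rw [hab, ← hh'] at hh
      exact congrArg Subtype.val (hg hh))
  refine ⟨Φ, ?_⟩
  -- All allocated houses lie in `W`, so an envious agent values a house of `W` and is in the domain
  -- of `g`. A real match would give that agent a valued house, so the match is a dummy.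
  have hE : ∀ a : {a // ∃ b, I.Envies Φ a b}, ∃ i ha, g ⟨a, ha⟩ = .inr i := by
    rintro ⟨a, b, hab⟩
    rw [envies_iff] at hab
    have ha : ∃ h ∈ W, I.u a h = 1 := ⟨Φ b, hΦW b, hab.2⟩
    cases hga : g ⟨a, ha⟩ with
    | inr i => exact ⟨i, ha, hga⟩
    | inl h =>
      refine absurd ?_ hab.1
      rw [hΦ a (by simpa using ⟨ha, h, hga⟩), hf a ha h hga]
      exact (hgW _ _ hga).2
  choose i ha hi using hE
  rw [numEnvious_eq, ← Fintype.card_subtype]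
  refine (Fintype.card_le_of_injective i fun a b hab => ?_).trans (by simp)
  have := (hi a).trans ((congrArg Sum.inr hab).trans (hi b).symm)
  exact Subtype.ext (Subtype.mk.inj (hg this))

/-- Hall's condition with `k` dummies adjacent to every agent. The houses of `W` valued within a set
`X` form an initial piece and a final piece, determined by its most demanding members in and outside
`L`. -/
theorem IsSplit.isYes_of_criterion {pos : Equiv.Perm (Fin I.m)} {L : Fin I.n → Prop}
    (hL : I.IsSplit pos L) (h : I.Criterion L) : I.IsYes := by
  classical
  obtain ⟨s, -, t, -, hst, hk⟩ := h
  have hW : Finset.card {h | s ≤ (pos h : ℕ) ∧ pos h + t < I.m} = I.m - t - s := by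
    rw [card_filter_perm pos fun x => s ≤ x ∧ x + t < I.m, ← Nat.card_Ico]
    congr 1
    ext x
    simp
    omega
  generalize hWdef : ({h | s ≤ (pos h : ℕ) ∧ pos h + t < I.m} : Finset (Fin I.m)) = W at hW
  have hmem : ∀ h, h ∈ W ↔ s ≤ (pos h : ℕ) ∧ pos h + t < I.m := by simp [← hWdef]
  suffices hall : ∀ X : Finset {a // ∃ h ∈ W, I.u a h = 1}, X.card ≤ (X.biUnion fun a =>
      ({h ∈ W | I.u a h = 1} : Finset _).disjSum (Finset.univ : Finset (Fin I.k))).card by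
    obtain ⟨g, hg, hgm⟩ := (Finset.all_card_le_biUnion_card_iff_exists_injective _).1 hall
    refine isYes_of_matching (by omega) g hg fun a h hh => ?_
    have := hgm a
    rw [hh, Finset.inl_mem_disjSum] at this
    simpa using this
  intro X
  rcases X.eq_empty_or_nonempty with rfl | ⟨x₀, hx₀⟩
  · simp
  -- The maximum with `s` makes the initial piece empty, of length `p - s = 0`, when `X` has no
  -- agent in `L`; likewise `q` with `t`.
  obtain ⟨p, hp⟩ : ∃ p, p = max s ((X.filter fun x => L x.1).sup fun x => I.numValued x.1) := ⟨_, rfl⟩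
  obtain ⟨q, hq⟩ : ∃ q, q = max t ((X.filter fun x => ¬ L x.1).sup fun x => I.numValued x.1) :=
    ⟨_, rfl⟩
  have hpm : p ≤ I.m := hp ▸ max_le (by omega) (Finset.sup_le fun x _ => numValued_le _)
  have hqm : q ≤ I.m := hq ▸ max_le (by omega) (Finset.sup_le fun x _ => numValued_le _)
  have hXL : (X.filter fun x => L x.1).card ≤ I.count L s p := by
    refine Finset.card_le_card_of_injOn Subtype.val (fun x hx => ?_) Subtype.val_injective.injOn
    have hle := Finset.le_sup (f := fun x : {a // ∃ h ∈ W, I.u a h = 1} => I.numValued x) hx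
    obtain ⟨h, hhW, hu⟩ := x.2
    simp only [Finset.coe_filter, Set.mem_ofPred_eq, Finset.mem_univ, true_and] at hx ⊢
    rw [hL.left _ hx.2] at hu
    rw [hmem] at hhW
    exact ⟨hx.2, by omega, hle.trans (hp ▸ le_max_right _ _)⟩
  have hXR : (X.filter fun x => ¬ L x.1).card ≤ I.count (fun b => ¬ L b) t q := by
    refine Finset.card_le_card_of_injOn Subtype.val (fun x hx => ?_) Subtype.val_injective.injOn
    have hle := Finset.le_sup (f := fun x : {a // ∃ h ∈ W, I.u a h = 1} => I.numValued x) hx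
    obtain ⟨h, hhW, hu⟩ := x.2
    simp only [Finset.coe_filter, Set.mem_ofPred_eq, Finset.mem_univ, true_and] at hx ⊢
    rw [hL.right _ hx.2] at hu
    rw [hmem] at hhW
    exact ⟨hx.2, by omega, hle.trans (hq ▸ le_max_right _ _)⟩
  have hX := Finset.card_filter_add_card_filter_not (s := X) fun x => L x.1
  have hXn : X.card ≤ I.n :=
    X.card_le_univ.trans ((Fintype.card_subtype_le _).trans (by simp))
  have hC : X.card ≤ Finset.card {h ∈ W | (pos h : ℕ) < p ∨ I.m ≤ pos h + q} + I.k := by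
    have hWC : ({h ∈ W | (pos h : ℕ) < p ∨ I.m ≤ pos h + q} : Finset (Fin I.m)) =
        ({h | (s ≤ (pos h : ℕ) ∧ pos h + t < I.m) ∧ ((pos h : ℕ) < p ∨ I.m ≤ pos h + q)} :
          Finset (Fin I.m)) := by
      ext h
      simp [hmem]
    rw [hWC, card_filter_perm pos
      fun x => (s ≤ x ∧ x + t < I.m) ∧ (x < p ∨ I.m ≤ x + q)]
    -- Either the two pieces cover `W`, which has at least `n` houses, or they are disjoint and the
    -- criterion at `p`, `q` bounds `X`.
    rcases le_or_gt I.m (p + q) with hpq | hpq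
    · refine (hXn.trans ?_).trans (Nat.le_add_right _ _)
      refine le_trans (b := (Finset.Ico s (I.m - t)).card) (by simp; omega) ?_
      exact Finset.card_le_card fun x hx => by simp at hx ⊢; omega
    · have := hk p (by omega) q (by omega)
      have hsp : s ≤ p := hp ▸ le_max_left _ _
      have htq : t ≤ q := hq ▸ le_max_left _ _
      have hdisj : Disjoint (Finset.Ico s p) (Finset.Ico (I.m - q) (I.m - t)) := by
        rw [Finset.disjoint_left]
        intro x hx hx'
        simp at hx hx'
        omega
      have hsub := Finset.card_le_card (s := Finset.Ico s p ∪ Finset.Ico (I.m - q) (I.m - t))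
        (t := {x ∈ Finset.range I.m | (s ≤ x ∧ x + t < I.m) ∧ (x < p ∨ I.m ≤ x + q)})
        fun x hx => by simp at hx ⊢; omega
      rw [Finset.card_union_of_disjoint hdisj, Nat.card_Ico, Nat.card_Ico] at hsub
      omega
  refine (hC.trans (by simp)).trans (Finset.card_le_card (s :=
    ({h ∈ W | (pos h : ℕ) < p ∨ I.m ≤ pos h + q} : Finset (Fin I.m)).disjSum
      (Finset.univ : Finset (Fin I.k))) fun y hy => ?_)
  rw [Finset.mem_biUnion]
  cases y with
  -- The dummies occur in the neighbourhood only because `X` is nonempty.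
  | inr i => exact ⟨x₀, hx₀, by simp⟩
  | inl h =>
    rw [Finset.inl_mem_disjSum, Finset.mem_filter] at hy
    obtain ⟨hhW, hlt | hle⟩ := hy
    · have hlt' : (pos h : ℕ) < (X.filter fun x => L x.1).sup fun x => I.numValued x.1 := by
        have := (hmem h).1 hhW
        omega
      obtain ⟨x, hx, hxlt⟩ := Finset.lt_sup_iff.1 hlt'
      rw [Finset.mem_filter] at hx
      exact ⟨x, hx.1, by simpa [hhW] using (hL.left _ hx.2 h).2 hxlt⟩
    · have hlt' : I.m - 1 - (pos h : ℕ) < (X.filter fun x => ¬ L x.1).sup fun x => I.numValued x.1 := by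
        have := (hmem h).1 hhW
        omega
      obtain ⟨x, hx, hxlt⟩ := Finset.lt_sup_iff.1 hlt'
      rw [Finset.mem_filter] at hx
      exact ⟨x, hx.1, by simpa [hhW] using (hL.right _ hx.2 h).2 (by omega)⟩

end Criterion

end BinaryOHA

/-! ### Expressing the criterion as a bounded-sum term. -/

namespace BinaryOHA

open RAM

/-- The utility of agent `a` for house `h`, and `0` if there is no such agent or house. -/
def util (I : BinaryOHA) (a h : ℕ) : ℕ := if h < I.m then I.input.arr 0 (a * I.m + h) else 0

variable {I : BinaryOHA}

theorem util_coe (a : Fin I.n) (h : Fin I.m) : I.util a h = I.u a h := by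
  have hlt : (a : ℕ) * I.m + h < I.n * I.m := by
    calc (a : ℕ) * I.m + h < a * I.m + I.m := by omega
      _ = (a + 1) * I.m := by ring
      _ ≤ I.n * I.m := Nat.mul_le_mul_right _ a.2
  have hdiv : ((a : ℕ) * I.m + h) / I.m = a := by
    rw [mul_comm, Nat.mul_add_div h.pos, Nat.div_eq_of_lt h.2, add_zero]
  have hmod : ((a : ℕ) * I.m + h) % I.m = h := by
    rw [mul_comm, Nat.mul_add_mod, Nat.mod_eq_of_lt h.2]
  have h1 : Fin.divNat (⟨a * I.m + h, hlt⟩ : Fin (I.n * I.m)) = a := Fin.ext hdiv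
  have h2 : Fin.modNat (⟨a * I.m + h, hlt⟩ : Fin (I.n * I.m)) = h := Fin.ext hmod
  simp only [util, h.2, if_true, input, hlt, dif_pos, h1, h2]

/-- Row indices from `n` on read beyond the matrix, where the input is 0. Sums over agents may
therefore run past `n`. -/
theorem util_of_le {a : ℕ} (ha : I.n ≤ a) (h : ℕ) : I.util a h = 0 := by
  have : ¬ a * I.m + h < I.n * I.m := by
    have := Nat.mul_le_mul_right I.m ha
    omega
  simp [util, input, this]

theorem sum_range_eq_sum_fin {m N : ℕ} (hmN : m ≤ N) {f : ℕ → ℕ} (hf : ∀ i, m ≤ i → f i = 0) :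
    ∑ i ∈ Finset.range N, f i = ∑ i : Fin m, f i := by
  rw [← Finset.sum_range, ← Finset.sum_subset (Finset.range_mono hmN)]
  intro x _ hx
  exact hf x (by simpa using hx)

theorem sum_util (a : Fin I.n) :
    ∑ h ∈ Finset.range (I.n + I.m + 1), I.util a h = I.numValued a := by
  rw [sum_range_eq_sum_fin (m := I.m) (by omega) fun i hi => by simp [util, hi.not_gt], numValued,
    Finset.card_filter]
  refine Finset.sum_congr rfl fun h _ => ?_
  rw [util_coe]
  generalize I.u a h = x
  revert x
  decide

theorem sum_util_sub_eq_zero_iff (a b : Fin I.n) :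
    ∑ h ∈ Finset.range (I.n + I.m + 1), (I.util a h - I.util b h) = 0 ↔
      ∀ h, I.u a h = 1 → I.u b h = 1 := by
  rw [sum_range_eq_sum_fin (m := I.m) (by omega) fun i hi => by simp [util, hi.not_gt],
    Finset.sum_eq_zero_iff]
  simp only [Finset.mem_univ, true_imp_iff, util_coe]
  refine forall_congr' fun h => ?_
  generalize I.u a h = x
  generalize I.u b h = y
  revert x y
  decide

/-- Product of a variable with the number of houses. -/
def mulTm (a : ℕ) : Tm := .sum 3 (.ite (.sub (.var a) (.var 3)) (.var 1) (.const 0))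

/-- Utility of an agent for a house. -/
def utilTm (a h : ℕ) : Tm :=
  .ite (.sub (.var 1) (.var h)) (.get (.add (mulTm a) (.var h))) (.const 0)

/-- Number of houses valued by an agent. -/
def numTm (a : ℕ) : Tm := .sum 4 (utilTm a 4)

/-- Number of houses valued by the agent `a` and not by the agent `b`. -/
def diffTm (a b : ℕ) : Tm := .sum 4 (.sub (utilTm a 4) (utilTm b 4))

/-- Whether the number of houses valued by an agent is more than `s` and at most `p`. -/
def betweenTm (b s p : ℕ) : Tm :=
  .ite (.sub (numTm b) (.var s)) (.ite (.sub (numTm b) (.var p)) (.const 0) (.const 1)) (.const 0)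

/-- Number of agents who value every house valued by `a`, and more than `s` and at most `p`
houses. -/
def leftTm (a s p : ℕ) : Tm := .sum 10 (.ite (diffTm a 10) (.const 0) (betweenTm 10 s p))

/-- Number of agents who do not value every house valued by `a`, and who value more than `s` and at
most `p` houses. -/
def rightTm (a s p : ℕ) : Tm := .sum 10 (.ite (diffTm a 10) (betweenTm 10 s p) (.const 0))

/-- Zero if the agent `a` values a smallest nonempty set of houses. -/
def minTm (a : ℕ) : Tm := .sum 10 (.ite (numTm 10)
  (.add (.sub (numTm a) (numTm 10)) (.sub (.const 1) (numTm a))) (.const 0))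

/-- Zero if discarding the first `s = x₆` and the last `t = x₇` houses leaves enough houses and at
most `k` agents without a house. -/
def windowTm : Tm := .add (.sub (.add (.add (.var 6) (.var 7)) (.var 0)) (.var 1))
  (.sum 8 (.sum 9 (.sub (.add (.sub (leftTm 5 6 8) (.sub (.var 8) (.var 6)))
    (.sub (rightTm 5 7 9) (.sub (.var 9) (.var 7)))) (.var 2))))

/-- The answer. -/
def decisionTm : Tm := .ite (.var 0)
  (.ite (.sum 5 (.ite (.sub (.var 0) (.var 5)) (.ite (minTm 5) (.const 0)
    (.sum 6 (.sum 7 (.ite windowTm (.const 0) (.const 1))))) (.const 0))) (.const 1) (.const 0))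
  (.const 1)

/-! ### Correctness of the terms. -/

section Eval

variable {ρ : ℕ → ℕ}

local notation "ev" => Tm.eval (I.input.arr 0) (I.n + I.m + 1)

/-- Multiplication is repeated addition of `m`, which is exact because `ρ a` is below the length of
sums. The condition `a ≠ 3` here, and those with 4 and 10 below, prevent capture by bound variables.
-/
theorem eval_utilTm (h1 : ρ 1 = I.m) {a h : ℕ} (ha : a ≠ 3) (hn : ρ a < I.n + I.m + 1) :
    ev (utilTm a h) ρ = I.util (ρ a) (ρ h) := by
  have hmul : ev (mulTm a) ρ = ρ a * I.m := by
    simp only [mulTm, Tm.eval, Function.update_of_ne ha, Function.update_self, ne_eq,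
      Nat.sub_eq_zero_iff_le, not_le, h1, show (1 : ℕ) ≠ 3 by decide, not_false_eq_true,
      Function.update_of_ne]
    rw [← Finset.sum_filter, Finset.sum_const, smul_eq_mul]
    congr 1
    rw [← Finset.card_range (ρ a)]
    congr 1
    ext x
    simp
    omega
  simp only [utilTm, Tm.eval, hmul, util, h1, ne_eq, Nat.sub_eq_zero_iff_le, not_le]

theorem eval_numTm (h1 : ρ 1 = I.m) {a : ℕ} (ha : a ≠ 3) (ha' : a ≠ 4) {b : Fin I.n}
    (hb : ρ a = b) : ev (numTm a) ρ = I.numValued b := by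
  rw [← sum_util, numTm, Tm.eval]
  refine Finset.sum_congr rfl fun h _ => ?_
  rw [eval_utilTm (by simpa using h1) ha (by rw [Function.update_of_ne ha', hb]; omega),
    Function.update_self, Function.update_of_ne ha', hb]

theorem eval_numTm_of_le (h1 : ρ 1 = I.m) {a : ℕ} (ha : a ≠ 3) (ha' : a ≠ 4) (hn : I.n ≤ ρ a)
    (hN : ρ a < I.n + I.m + 1) : ev (numTm a) ρ = 0 := by
  rw [numTm, Tm.eval]
  refine Finset.sum_eq_zero fun h _ => ?_
  rw [eval_utilTm (by simpa using h1) ha (by rwa [Function.update_of_ne ha']),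
    Function.update_of_ne ha', util_of_le hn]

theorem eval_diffTm (h1 : ρ 1 = I.m) {a b : ℕ} (ha : a ≠ 3) (ha' : a ≠ 4) (hb : b ≠ 3)
    (hb' : b ≠ 4) {c d : Fin I.n} (hc : ρ a = c) (hd : ρ b = d) :
    ev (diffTm a b) ρ = 0 ↔ ∀ h, I.u c h = 1 → I.u d h = 1 := by
  rw [← sum_util_sub_eq_zero_iff, diffTm, Tm.eval]
  refine Eq.congr_left (Finset.sum_congr rfl fun h _ => ?_)
  rw [Tm.eval, eval_utilTm (by simpa using h1) ha (by rw [Function.update_of_ne ha', hc]; omega),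
    eval_utilTm (by simpa using h1) hb (by rw [Function.update_of_ne hb', hd]; omega),
    Function.update_self, Function.update_of_ne ha', Function.update_of_ne hb', hc, hd]

theorem eval_betweenTm (h1 : ρ 1 = I.m) {a s p : ℕ} (ha : a ≠ 3) (ha' : a ≠ 4) {b : Fin I.n}
    (hb : ρ a = b) : ev (betweenTm a s p) ρ =
      if ρ s < I.numValued b ∧ I.numValued b ≤ ρ p then 1 else 0 := by
  simp only [betweenTm, Tm.eval, eval_numTm h1 ha ha' hb]
  split_ifs <;> omega

theorem eval_betweenTm_of_le (h1 : ρ 1 = I.m) {a s p : ℕ} (ha : a ≠ 3) (ha' : a ≠ 4)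
    (hn : I.n ≤ ρ a) (hN : ρ a < I.n + I.m + 1) : ev (betweenTm a s p) ρ = 0 := by
  simp [betweenTm, Tm.eval, eval_numTm_of_le h1 ha ha' hn hN]

theorem sum_range_update {f : (ℕ → ℕ) → ℕ} {x : ℕ} {g : Fin I.n → ℕ}
    (hle : ∀ i, I.n ≤ i → i < I.n + I.m + 1 → f (Function.update ρ x i) = 0)
    (hg : ∀ b : Fin I.n, f (Function.update ρ x b) = g b) :
    ∑ i ∈ Finset.range (I.n + I.m + 1), f (Function.update ρ x i) = ∑ b, g b := by
  rw [← Finset.sum_congr rfl fun b _ => hg b,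
    ← Finset.sum_range fun i => f (Function.update ρ x i),
    ← Finset.sum_subset (Finset.range_mono (by omega : I.n ≤ I.n + I.m + 1))]
  intro i hi hi'
  rw [Finset.mem_range] at hi hi'
  exact hle i (by omega) hi

theorem eval_leftTm (h1 : ρ 1 = I.m) {a s p : ℕ} (ha : a ≠ 3) (ha' : a ≠ 4) (ha₁ : a ≠ 10)
    (hs : s ≠ 10) (hp : p ≠ 10) {c : Fin I.n} (hc : ρ a = c) : ev (leftTm a s p) ρ =
      I.count (fun b => ∀ h, I.u c h = 1 → I.u b h = 1) (ρ s) (ρ p) := by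
  classical
  rw [leftTm, Tm.eval, count, Finset.card_filter]
  refine sum_range_update (f := fun ρ => ev _ ρ) (fun i hi hN => ?_) fun b => ?_
  · simp only [Tm.eval]
    rw [eval_betweenTm_of_le (by simpa using h1) (by decide) (by decide) (by simpa using hi)
      (by simpa using hN), ite_self]
  · simp only [Tm.eval]
    rw [eval_betweenTm (b := b) (by simpa using h1) (by decide) (by decide) (by simp),
      Function.update_of_ne hs, Function.update_of_ne hp]
    have hd := eval_diffTm (I := I) (ρ := Function.update ρ 10 b) (a := a) (b := 10) (c := c)
      (d := b) (by simpa using h1) ha ha' (by decide) (by decide) (by simpa [ha₁] using hc)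
      (by simp)
    split_ifs <;> tauto

theorem eval_rightTm (h1 : ρ 1 = I.m) {a s p : ℕ} (ha : a ≠ 3) (ha' : a ≠ 4) (ha₁ : a ≠ 10)
    (hs : s ≠ 10) (hp : p ≠ 10) {c : Fin I.n} (hc : ρ a = c) : ev (rightTm a s p) ρ =
      I.count (fun b => ¬ ∀ h, I.u c h = 1 → I.u b h = 1) (ρ s) (ρ p) := by
  classical
  rw [rightTm, Tm.eval, count, Finset.card_filter]
  refine sum_range_update (f := fun ρ => ev _ ρ) (fun i hi hN => ?_) fun b => ?_
  · simp only [Tm.eval]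
    rw [eval_betweenTm_of_le (by simpa using h1) (by decide) (by decide) (by simpa using hi)
      (by simpa using hN), ite_self]
  · simp only [Tm.eval]
    rw [eval_betweenTm (b := b) (by simpa using h1) (by decide) (by decide) (by simp),
      Function.update_of_ne hs, Function.update_of_ne hp]
    have hd := eval_diffTm (I := I) (ρ := Function.update ρ 10 b) (a := a) (b := 10) (c := c)
      (d := b) (by simpa using h1) ha ha' (by decide) (by decide) (by simpa [ha₁] using hc)
      (by simp)
    split_ifs <;> tauto

theorem eval_minTm (h1 : ρ 1 = I.m) {a : ℕ} (ha : a ≠ 3) (ha' : a ≠ 4) (ha₁ : a ≠ 10)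
    {c : Fin I.n} (hc : ρ a = c) : ev (minTm a) ρ = 0 ↔
      ∀ b, I.numValued b ≠ 0 → I.numValued c ≠ 0 ∧ I.numValued c ≤ I.numValued b := by
  have : ev (minTm a) ρ = ∑ b, if I.numValued b ≠ 0 then
      (I.numValued c - I.numValued b) + (1 - I.numValued c) else 0 := by
    rw [minTm, Tm.eval]
    refine sum_range_update (f := fun ρ => ev _ ρ) (fun i hi hN => ?_) fun b => ?_
    · simp only [Tm.eval]
      rw [eval_numTm_of_le (a := 10) (by simpa using h1) (by decide) (by decide) (by simpa using hi)
        (by simpa using hN), if_neg (by simp)]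
    · simp only [Tm.eval]
      rw [eval_numTm (a := 10) (b := b) (by simpa using h1) (by decide) (by decide) (by simp),
        eval_numTm (a := a) (b := c) (by simpa using h1) ha ha' (by simpa [ha₁] using hc)]
  rw [this, Finset.sum_eq_zero_iff]
  simp only [Finset.mem_univ, true_imp_iff]
  refine forall_congr' fun b => ?_
  split_ifs <;> omega

theorem eval_windowTm (h0 : ρ 0 = I.n) (h1 : ρ 1 = I.m) (h2 : ρ 2 = I.k) {c : Fin I.n}
    (hc : ρ 5 = c) : ev windowTm ρ = 0 ↔ ρ 6 + ρ 7 + I.n ≤ I.m ∧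
      ∀ p < I.n + I.m + 1, ∀ q < I.n + I.m + 1,
        (I.count (fun b => ∀ h, I.u c h = 1 → I.u b h = 1) (ρ 6) p - (p - ρ 6)) +
          (I.count (fun b => ¬ ∀ h, I.u c h = 1 → I.u b h = 1) (ρ 7) q - (q - ρ 7)) ≤ I.k := by
  simp only [windowTm, Tm.eval, Nat.add_eq_zero_iff, Finset.sum_eq_zero_iff, Finset.mem_range,
    Nat.sub_eq_zero_iff_le, h0, h1]
  refine and_congr_right fun _ => forall₂_congr fun p _ => forall₂_congr fun q _ => ?_
  rw [eval_leftTm (c := c) (by simpa using h1) (by decide) (by decide) (by decide) (by decide)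
    (by decide) (by simpa using hc), eval_rightTm (c := c) (by simpa using h1) (by decide)
    (by decide) (by decide) (by decide) (by decide) (by simpa using hc)]
  simp [h2]

theorem eval_decisionTm (hI : I.IsExtremal) (h0 : ρ 0 = I.n) (h1 : ρ 1 = I.m) (h2 : ρ 2 = I.k) :
    (I.IsYes → ev decisionTm ρ = 1) ∧ (¬ I.IsYes → ev decisionTm ρ = 0) := by
  -- Without agents there is no `a` to choose, and the empty allocation answers yes.
  rcases Nat.eq_zero_or_pos I.n with hn | hn
  · have : IsEmpty (Fin I.n) := Fintype.card_eq_zero_iff.1 ((Fintype.card_fin _).trans hn)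
    have hyes : I.IsYes := ⟨Function.Embedding.ofIsEmpty, by
      rw [numEnvious, Set.eq_empty_of_isEmpty {a | _}, Set.ncard_empty]
      exact Nat.zero_le _⟩
    exact ⟨fun _ => by simp [decisionTm, Tm.eval, h0, hn], fun h => absurd hyes h⟩
  -- Every minimal `a` yields a valid split, so it does not matter which one is found. If all valued
  -- sets are empty, every agent counts as minimal.
  have key : (∃ a : Fin I.n,
      (∀ b, I.numValued b ≠ 0 → I.numValued a ≠ 0 ∧ I.numValued a ≤ I.numValued b) ∧
        I.Criterion fun b => ∀ h, I.u a h = 1 → I.u b h = 1) ↔ I.IsYes := by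
    constructor
    · rintro ⟨a, ha, hc⟩
      obtain ⟨pos, hpos⟩ := hI.exists_isSplit a ha
      exact hpos.isYes_of_criterion hc
    · intro hyes
      obtain ⟨a, ha⟩ : ∃ a : Fin I.n,
          ∀ b, I.numValued b ≠ 0 → I.numValued a ≠ 0 ∧ I.numValued a ≤ I.numValued b := by
        by_cases hall : ∀ b : Fin I.n, I.numValued b = 0
        · exact ⟨⟨0, hn⟩, fun b hb => absurd (hall b) hb⟩
        · push Not at hall
          obtain ⟨b₀, hb₀⟩ := hall
          have : Nonempty {b : Fin I.n // I.numValued b ≠ 0} := ⟨⟨b₀, hb₀⟩⟩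
          obtain ⟨a, ha⟩ := Finite.exists_min fun b : {b : Fin I.n // I.numValued b ≠ 0} =>
            I.numValued b
          exact ⟨a, fun b hb => ⟨a.2, ha ⟨b, hb⟩⟩⟩
      obtain ⟨pos, hpos⟩ := hI.exists_isSplit a ha
      exact ⟨a, ha, hpos.criterion_of_isYes hyes⟩
  have hsum : ev (.sum 5 (.ite (.sub (.var 0) (.var 5)) (.ite (minTm 5) (.const 0)
      (.sum 6 (.sum 7 (.ite windowTm (.const 0) (.const 1))))) (.const 0))) ρ ≠ 0 ↔ I.IsYes := by
    have hex : ev (.sum 5 (.ite (.sub (.var 0) (.var 5)) (.ite (minTm 5) (.const 0)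
        (.sum 6 (.sum 7 (.ite windowTm (.const 0) (.const 1))))) (.const 0))) ρ ≠ 0 ↔
        ∃ a ≤ I.n + I.m, a < I.n ∧ ev (minTm 5) (Function.update ρ 5 a) = 0 ∧
          ∃ s ≤ I.n + I.m, ∃ t ≤ I.n + I.m, ev windowTm
            (Function.update (Function.update (Function.update ρ 5 a) 6 s) 7 t) = 0 := by
      simp [Tm.eval, h0, Nat.sub_eq_zero_iff_le]
    rw [hex, ← key]
    constructor
    · rintro ⟨a, -, han, hmin, s, hs, t, ht, hw⟩
      rw [eval_minTm (c := ⟨a, han⟩) (by simpa using h1) (by decide) (by decide) (by decide)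
        (by simp)] at hmin
      rw [eval_windowTm (c := ⟨a, han⟩) (by simpa using h0) (by simpa using h1)
        (by simpa using h2) (by simp)] at hw
      exact ⟨⟨a, han⟩, hmin, s, by omega, t, by omega, by simpa using hw⟩
    · rintro ⟨a, hmin, s, hs, t, ht, hw⟩
      refine ⟨a, by omega, a.2, (eval_minTm (c := a) (by simpa using h1) (by decide) (by decide)
        (by decide) (by simp)).2 hmin, s, by omega, t, by omega, (eval_windowTm (c := a)
        (by simpa using h0) (by simpa using h1) (by simpa using h2) (by simp)).2 (by simpa using hw)⟩
  have hite : ∀ e : Tm, ev (.ite (.var 0) (.ite e (.const 1) (.const 0)) (.const 1)) ρ =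
      if ev e ρ ≠ 0 then 1 else 0 := fun e => by simp [Tm.eval, h0, hn.ne']
  rw [decisionTm, hite]
  exact ⟨fun h => if_pos (hsum.2 h), fun h => if_neg (mt hsum.1 h)⟩

end Eval

end BinaryOHA

/-! ### The polynomial-time program. -/

theorem mainTheorem6 :
    RAM.SolvableInPolyTime BinaryOHA.input BinaryOHA.size BinaryOHA.IsExtremal
      BinaryOHA.IsYes := by
  -- Register 3 receives the length of sums, `size + 1`, hence the composition with `X + 1`.
  -- Variables 0, 1, 2 are the inputs; the others are bound in `decisionTm`, so sending them to
  -- register 0 is only a default below 4. The two outer assignments cost 6 and 2.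
  refine ⟨.seq (.assign 3 (.add (.add (.reg 0) (.reg 1)) (.const 1)))
    (.seq (BinaryOHA.decisionTm.compile (fun y => if y < 3 then y else 0) 4)
      (.assign 0 (.reg 4))),
    BinaryOHA.decisionTm.cost.comp (Polynomial.X + 1) + 8, fun I hI => ?_⟩
  obtain ⟨s₁, hs₁⟩ : ∃ s₁ : RAM.Store, s₁ = I.input.setReg 3 (I.n + I.m + 1) := ⟨_, rfl⟩
  have h₁ : RAM.Exec (.assign 3 (.add (.add (.reg 0) (.reg 1)) (.const 1))) I.input s₁ 6 := by
    subst hs₁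
    exact RAM.Exec.assign _ _ _
  have hA : s₁.arr = I.input.arr := by rw [hs₁]; rfl
  obtain ⟨s₂, t, h₂, ht, hv, -, -⟩ := BinaryOHA.decisionTm.computes_compile
    (fun y => if y < 3 then y else 0) 4 (fun y => s₁.reg (if y < 3 then y else 0)) s₁
    (I.n + I.m + 1) (by decide) (fun y => by split_ifs <;> omega)
    (by simp [hs₁, RAM.Store.setReg]) (fun _ => rfl)
  refine ⟨_, _, .seq h₁ (.seq h₂ (.assign _ _ _)), ?_, ?_⟩
  · simp only [RAM.Expr.cost, BinaryOHA.size, Polynomial.eval_add, Polynomial.eval_comp,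
      Polynomial.eval_X, Polynomial.eval_one, Polynomial.eval_ofNat]
    omega
  · have hreg : ((s₂.setReg 0 (RAM.Expr.eval s₂ (.reg 4))).reg 0) = s₂.reg 4 := by
      simp [RAM.Store.setReg, RAM.Expr.eval]
    rw [hreg, hv, hA]
    exact BinaryOHA.eval_decisionTm hI (by simp [hs₁, RAM.Store.setReg, BinaryOHA.input])
      (by simp [hs₁, RAM.Store.setReg, BinaryOHA.input])
      (by simp [hs₁, RAM.Store.setReg, BinaryOHA.input])
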